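/- Let $q\ge 2$ be an integer and let $\mathcal X$ be a homogeneous tree of degree $q+1$ (a connected graph without cycles in which every vertex has $q+1$ neighbours), with graph distance $d$, a fixed base vertex $o$, and $|x|=d(o,x)$. Let $\Omega$ be the set of infinite geodesic rays $\omega=(\omega_0,\omega_1,\dots)$ with $\omega_0=o$. For $x\in\mathcal X$ and $\omega\in\Omega$ let $c(x,\omega)$ be the last vertex of the geodesic path from $o$ to $x$ that lies on $\omega$, and let $E(x)=\{\omega\in\Omega:|c(x,\omega)|\ge|x|\}$ be the set of rays through $x$. Let $\nu$ be the probability measure on the $\sigma$-algebra generated by the sets $E(x)$ with $\nu(E(o))=1$ and $\nu(E(x))=\frac{1}{(q+1)q^{|x|-1}}$ for $x\ne o$, and let $L^r(\Omega)=L^r(\Omega,\nu)$ (complex-valued functions). The Poisson kernel is $p(x,\omega)=q^{2|c(x,\omega)|-|x|}$, and for $z\in\mathbb C$ and $F\in L^1(\Omega)$ the Poisson transform is $$\mathcal P_zF(x)=\int_\Omega p(x,\omega)^{1/2+iz}F(\omega)\,d\nu(\omega),\qquad x\in\mathcal X.$$ Let $\phi_z=\mathcal P_z\mathbf 1$, which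 depends only on $|x|$; write $\phi_z(n)$ for its value on $S(o,n)=\{x:|x|=n\}$. For $1\le p\le 2$ put $\delta_p=\frac1p-\frac12$ and $\delta_{p'}=-\delta_p$; one has $\phi_{i\delta_p}>0$. For $u:\mathcal X\to\mathbb C$ define $$\|u\|_{\mathcal H^r_p(\mathcal X)}=\sup_{n\ge 0}\ \phi_{i\delta_p}(n)^{-1}\Bigl(\frac1{\#S(o,n)}\sum_{|x|=n}|u(x)|^r\Bigr)^{1/r}\quad(1\le r<\infty),\qquad \|u\|_{\mathcal H^\infty_p(\mathcal X)}=\sup_{x\in\mathcal X}\phi_{i\delta_p}(x)^{-1}|u(x)|.$$ (The average over $S(o,n)$ is the integral $\int_K|u(k\cdot\omega_n)|^r\,dk$ over the stabilizer $K$ of $o$ in the isometry group of $\mathcal X$, with normalized Haar measure, for any ray $(\omega_n)\in\Omega$.) Let $\tau=2\pi/\log q$. **Proposition.** Let $1\le p\le 2$. There is a constant $C_p>0$, depending only on $p$, such that for every $z=\alpha+i\delta_{p'}$, where $\alpha\in\mathbb R$ is arbitrary if $1\le p<2$ and $\alpha\in(\tau/2)\mathbb Z$ if $p=2$, $$C_p\,\|F\|_{L^r(\Omega)}\le\|\mathcal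 P_zF\|_{\mathcal H^r_p(\mathcal X)}\le\|F\|_{L^r(\Omega)}\qquad\text{for all }1\le r\le\infty\text{ and all }F\in L^r(\Omega).$$ -/

import Mathlib

open MeasureTheory
open scoped ENNReal

/-- `G` is a homogeneous tree of degree `q + 1`, with `q ≥ 2`. -/
structure IsHomogeneousTree {V : Type*} (G : SimpleGraph V) (q : ℕ) : Prop where
  isTree : G.IsTree
  two_le : 2 ≤ q
  ncard_neighborSet : ∀ v, (G.neighborSet v).ncard = q + 1

/-- The boundary `Ω` of the tree: infinite geodesic rays `ω₀, ω₁, ω₂, …` starting from `o`. -/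
structure TreeBoundary {V : Type*} (G : SimpleGraph V) (o : V) where
  vertex : ℕ → V
  vertex_zero : vertex 0 = o
  adj : ∀ n, G.Adj (vertex n) (vertex (n + 1))
  geodesic : ∀ m k, G.dist (vertex m) (vertex (m + k)) = k

namespace TreeBoundary

variable {V : Type*} {G : SimpleGraph V} {o : V} {q : ℕ}

/-- `c(x, ω)`: the last vertex of `ω` that lies on the geodesic path from `o` to `x`. A vertex `v`
lies on that path iff `d(o, v) + d(v, x) = d(o, x)`. -/
noncomputable def confluence (x : V) (ω : TreeBoundary G o) : V :=
  ω.vertex (sSup {j : ℕ | G.dist o (ω.vertex j) + G.dist (ω.vertex j) x = G.dist o x})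

/-- The sector `E_j(x) = {ω : |c(x, ω)| ≥ j}`. -/
def sectorFrom (G : SimpleGraph V) (o : V) (j : ℕ) (x : V) : Set (TreeBoundary G o) :=
  {ω | j ≤ G.dist o (confluence x ω)}

/-- The sector `E(x) = E_{|x|}(x)`. -/
def sector (G : SimpleGraph V) (o : V) (x : V) : Set (TreeBoundary G o) :=
  sectorFrom G o (G.dist o x) x

/-- The σ-algebra on `Ω` is generated by the sectors `E(x)`. -/
instance : MeasurableSpace (TreeBoundary G o) :=
  MeasurableSpace.generateFrom (Set.range (sector G o))

/-- The reciprocal of the number of vertices at distance `n` from `o`: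
`1` if `n = 0`, and `1 / ((q + 1) q ^ (n - 1))` otherwise. -/
noncomputable def sphereWeight (q n : ℕ) : ℝ≥0∞ :=
  if n = 0 then 1 else (((q : ℝ≥0∞) + 1) * (q : ℝ≥0∞) ^ (n - 1))⁻¹

theorem dist_vertex (ω : TreeBoundary G o) (n : ℕ) : G.dist o (ω.vertex n) = n := by
  have h := ω.geodesic 0 n
  rwa [ω.vertex_zero, zero_add] at h

/-- `E(x)` consists of the rays through `x`. -/
theorem mem_sector_iff (hG : G.Connected) (x : V) (ω : TreeBoundary G o) :
    ω ∈ sector G o x ↔ ω.vertex (G.dist o x) = x := by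
  set S : Set ℕ := {j : ℕ | G.dist o (ω.vertex j) + G.dist (ω.vertex j) x = G.dist o x} with hS
  have hb : ∀ j ∈ S, j ≤ G.dist o x := by
    intro j hj
    have hj' : G.dist o (ω.vertex j) + G.dist (ω.vertex j) x = G.dist o x := hj
    rw [dist_vertex] at hj'
    omega
  have hbdd : BddAbove S := ⟨_, hb⟩
  have h0 : (0 : ℕ) ∈ S := by simp [hS, ω.vertex_zero]
  have hmem : sSup S ∈ S := Nat.sSup_mem ⟨0, h0⟩ hbdd
  have key : ω ∈ sector G o x ↔ G.dist o x ≤ sSup S := by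
    change G.dist o x ≤ G.dist o (ω.vertex (sSup S)) ↔ _
    rw [dist_vertex]
  rw [key]
  constructor
  · intro h
    have he : sSup S = G.dist o x := le_antisymm (hb _ hmem) h
    rw [he] at hmem
    have hm : G.dist o (ω.vertex (G.dist o x)) + G.dist (ω.vertex (G.dist o x)) x
      = G.dist o x := hmem
    rw [dist_vertex] at hm
    exact hG.dist_eq_zero_iff.1 (by omega)
  · intro h
    refine le_csSup hbdd ?_
    change G.dist o (ω.vertex (G.dist o x)) + G.dist (ω.vertex (G.dist o x)) x = G.dist o x
    rw [h]; simp

theorem parent_unique (hG : G.IsTree) {x u u' : V} (h : G.Adj u x) (h' : G.Adj u' x)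
    (hd : G.dist o x = G.dist o u + 1) (hd' : G.dist o x = G.dist o u' + 1) : u = u' := by
  obtain ⟨p, hp⟩ := hG.connected.exists_walk_length_eq_dist o u
  obtain ⟨p', hp'⟩ := hG.connected.exists_walk_length_eq_dist o u'
  have e : p.concat h = p'.concat h' := by
    refine (hG.existsUnique_path o x).unique ?_ ?_ <;>
      refine SimpleGraph.Walk.isPath_of_length_eq_dist _ ?_ <;>
      rw [SimpleGraph.Walk.length_concat] <;> omega
  have e2 := congrArg SimpleGraph.Walk.penultimate e
  simpa using e2

theorem exists_parent (hG : G.Connected) {x : V} {n : ℕ} (h : G.dist o x = n + 1) :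
    ∃ u, G.Adj u x ∧ G.dist o u = n := by
  obtain ⟨p, hp⟩ := hG.exists_walk_length_eq_dist o x
  have hnil : ¬ p.Nil := by
    intro hn
    have := SimpleGraph.Walk.length_eq_zero_iff.2 hn
    omega
  refine ⟨p.penultimate, p.adj_penultimate hnil, ?_⟩
  have h1 : G.dist o p.penultimate ≤ n := by
    refine (SimpleGraph.dist_le p.dropLast).trans ?_
    rw [SimpleGraph.Walk.length_dropLast]; omega
  have h2 := hG.dist_triangle (u := o) (v := p.penultimate) (w := x)
  rw [SimpleGraph.dist_eq_one_iff_adj.2 (p.adj_penultimate hnil)] at h2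
  omega

theorem vertex_eq_of_le (hG : G.IsTree) {ω ω' : TreeBoundary G o} {n : ℕ}
    (h : ω.vertex n = ω'.vertex n) {m : ℕ} (hm : m ≤ n) : ω.vertex m = ω'.vertex m := by
  induction n with
  | zero => obtain rfl : m = 0 := by omega
            exact h
  | succ n ih =>
    rcases Nat.lt_or_ge n m with hlt | hge
    · obtain rfl : m = n + 1 := by omega
      exact h
    · refine ih ?_ hge
      have a := ω.adj n
      rw [h] at a
      refine parent_unique (o := o) hG a (ω'.adj n) ?_ ?_ <;> simp only [dist_vertex]

theorem sector_self (hG : G.Connected) : sector G o o = Set.univ := by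
  ext ω
  simp [mem_sector_iff hG, ω.vertex_zero]

theorem isPiSystem_sector (hG : G.IsTree) : IsPiSystem (Set.range (sector G o)) := by
  have key : ∀ x y, G.dist o x ≤ G.dist o y → (sector G o x ∩ sector G o y).Nonempty →
      sector G o x ∩ sector G o y = sector G o y := by
    rintro x y hxy ⟨ω, hx, hy⟩
    refine Set.inter_eq_right.2 fun ω' hω' => ?_
    rw [mem_sector_iff hG.connected] at *
    rw [← vertex_eq_of_le hG (hy.trans hω'.symm) hxy, hx]
  rintro _ ⟨x, rfl⟩ _ ⟨y, rfl⟩ h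
  rcases le_total (G.dist o x) (G.dist o y) with hle | hle
  · exact ⟨y, (key x y hle h).symm⟩
  · rw [Set.inter_comm] at h ⊢
    exact ⟨x, (key y x hle h).symm⟩

/-- The vertices following `v` on the rays from `o` through `v`. -/
def children (G : SimpleGraph V) (o v : V) : Set V :=
  {w | G.Adj v w ∧ G.dist o w = G.dist o v + 1}

theorem finite_children (hG : IsHomogeneousTree G q) (v : V) : (children G o v).Finite :=
  (Set.finite_of_ncard_ne_zero (s := G.neighborSet v)
    (by rw [hG.ncard_neighborSet]; omega)).subset fun _ hw => hw.1

theorem ncard_children (hG : IsHomogeneousTree G q) (v : V) :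
    (children G o v).ncard = if G.dist o v = 0 then q + 1 else q := by
  have hfin : (G.neighborSet v).Finite :=
    Set.finite_of_ncard_ne_zero (by rw [hG.ncard_neighborSet]; omega)
  split_ifs with h
  · rw [← hG.ncard_neighborSet v]
    congr 1
    ext w
    refine ⟨fun hw => hw.1, fun hw => ⟨hw, ?_⟩⟩
    rcases hG.isTree.dist_eq_dist_add_one_of_adj o (show G.Adj v w from hw) with h1 | h1 <;> omega
  · obtain ⟨n, hn⟩ := Nat.exists_eq_succ_of_ne_zero h
    obtain ⟨u, hu, hun⟩ := exists_parent hG.isTree.connected hn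
    have e : children G o v = G.neighborSet v \ {u} := by
      ext w
      constructor
      · rintro ⟨h1, h2⟩
        refine ⟨h1, ?_⟩
        rintro rfl
        omega
      · rintro ⟨h1, h2⟩
        refine ⟨h1, ?_⟩
        rcases hG.isTree.dist_eq_dist_add_one_of_adj o (show G.Adj v w from h1) with h3 | h3
        · exact absurd (parent_unique (o := o) hG.isTree (SimpleGraph.Adj.symm h1) hu h3 (by omega)) h2
        · exact h3
    rw [e, Set.ncard_sdiff_singleton_of_mem (show u ∈ G.neighborSet v from SimpleGraph.Adj.symm hu),
      hG.ncard_neighborSet]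
    rfl

theorem sphereWeight_succ (hq : 2 ≤ q) (n : ℕ) :
    sphereWeight q (n + 1) =
      (((if n = 0 then q + 1 else q : ℕ) : ℝ≥0∞))⁻¹ * sphereWeight q n := by
  rcases n with _ | n
  · simp [sphereWeight]
  · have hq0 : (q : ℝ≥0∞) ≠ 0 := by simp; omega
    simp only [sphereWeight, Nat.add_eq_zero_iff, one_ne_zero, and_false, if_false,
      Nat.add_sub_cancel]
    rw [← ENNReal.mul_inv (Or.inl hq0) (Or.inl (by simp))]
    congr 1
    ring

/-- The ray from `o` whose successive vertices are given by a choice of a child of each vertex. -/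
def ofChoice (hG : G.Connected) (y : ∀ v, children G o v) : TreeBoundary G o :=
  have hd : ∀ n, G.dist o (Nat.rec o (fun _ v => (y v).1) n : V) = n := by
    intro n
    induction n with
    | zero => simp
    | succ n ih => exact (y _).2.2.trans (by rw [ih])
  have ha : ∀ n, G.Adj (Nat.rec o (fun _ v => (y v).1) n : V)
      (Nat.rec o (fun _ v => (y v).1) (n + 1) : V) := fun n => (y _).2.1
  { vertex := fun n => Nat.rec o (fun _ v => (y v).1) n
    vertex_zero := rfl
    adj := ha
    geodesic := by
      intro m k
      refine le_antisymm ?_ ?_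
      · induction k with
        | zero => simp
        | succ k ih =>
          refine hG.dist_triangle.trans (add_le_add ih ?_)
          exact (SimpleGraph.dist_eq_one_iff_adj.2 (ha (m + k))).le
      · have h := hG.dist_triangle (u := o) (v := (Nat.rec o (fun _ v => (y v).1) m : V))
          (w := (Nat.rec o (fun _ v => (y v).1) (m + k) : V))
        rw [hd, hd] at h
        omega }

theorem setOf_ofChoice_eq (hG : IsHomogeneousTree G q) [∀ v, MeasurableSpace (children G o v)]
    (μ : ∀ v, Measure (children G o v))
    (hμ : ∀ v w, μ v {w} = (((children G o v).ncard : ℕ) : ℝ≥0∞)⁻¹) (n : ℕ) :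
    ∀ x, G.dist o x = n → ∃ (s : Finset V) (t : ∀ v, Set (children G o v)),
      (∀ v ∈ s, G.dist o v < n) ∧
      {y | (ofChoice hG.isTree.connected y).vertex n = x} = Set.pi s t ∧
      ∏ v ∈ s, μ v (t v) = sphereWeight q n := by
  classical
  induction n with
  | zero =>
    intro x hx
    obtain rfl : o = x := hG.isTree.connected.dist_eq_zero_iff.1 hx
    refine ⟨∅, fun _ => Set.univ, by simp, ?_, by simp [sphereWeight]⟩
    ext y
    simp [(ofChoice hG.isTree.connected y).vertex_zero]
  | succ n ih =>
    intro x hx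
    obtain ⟨u, hu, hun⟩ := exists_parent hG.isTree.connected hx
    obtain ⟨s, t, hs, hst, hprod⟩ := ih u hun
    have hus : u ∉ s := fun h => by have := hs u h; omega
    let c : children G o u := ⟨x, hu, by omega⟩
    refine ⟨insert u s, Function.update t u {c}, ?_, ?_, ?_⟩
    · intro v hv
      rcases Finset.mem_insert.1 hv with rfl | hv
      · omega
      · have := hs v hv; omega
    · have e : (((insert u s : Finset V) : Set V).pi (Function.update t u {c})) =
          {y | y u = c} ∩ Set.pi s t := by
        rw [Finset.coe_insert, Set.insert_pi]
        congr 1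
        · ext y; simp
        · refine Set.pi_congr rfl fun v hv => ?_
          rw [Function.update_of_ne]
          rintro rfl
          exact hus hv
      rw [e, ← hst]
      ext y
      have hstep : (ofChoice hG.isTree.connected y).vertex (n + 1) =
        (y ((ofChoice hG.isTree.connected y).vertex n)).1 := rfl
      simp only [Set.mem_ofPred_eq, Set.mem_inter_iff]
      constructor
      · intro h
        have hv : (ofChoice hG.isTree.connected y).vertex n = u := by
          have a := (ofChoice hG.isTree.connected y).adj n
          rw [h] at a
          refine parent_unique (o := o) hG.isTree a hu ?_ (by omega)
          rw [dist_vertex, hx]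
        refine ⟨?_, hv⟩
        rw [hstep, hv] at h
        exact Subtype.ext h
      · rintro ⟨h1, h2⟩
        rw [hstep, h2, h1]
    · rw [Finset.prod_insert hus, Function.update_self, hμ, ncard_children hG,
        sphereWeight_succ hG.two_le, ← hprod, hun]
      congr 1
      refine Finset.prod_congr rfl fun v hv => ?_
      rw [Function.update_of_ne]
      rintro rfl
      exact hus hv

/-- There is exactly one measure on `Ω` with `ν(E(x)) = 1` if `x = o` and
`ν(E(x)) = 1 / ((q + 1) q ^ (|x| - 1))` otherwise. -/
theorem existsUnique_measure (hG : IsHomogeneousTree G q) (o : V) :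
    ∃! ν : Measure (TreeBoundary G o), ∀ x, ν (sector G o x) = sphereWeight q (G.dist o x) := by
  classical
  have hc := hG.isTree.connected
  have huniv : ∀ ν : Measure (TreeBoundary G o),
      (∀ x, ν (sector G o x) = sphereWeight q (G.dist o x)) → ν Set.univ = 1 := by
    intro ν hν
    have := hν o
    rwa [sector_self hc, SimpleGraph.dist_self, sphereWeight, if_pos rfl] at this
  refine existsUnique_of_exists_of_unique ?_ ?_
  · let : ∀ v, Fintype (children G o v) := fun v => (finite_children hG v).fintype
    let : ∀ v, MeasurableSpace (children G o v) := fun v => ⊤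
    have : ∀ v, Nonempty (children G o v) := fun v => by
      have h : (children G o v).ncard ≠ 0 := by
        rw [ncard_children hG]
        have := hG.two_le
        split_ifs <;> omega
      exact (Set.nonempty_of_ncard_ne_zero h).to_subtype
    let μ : ∀ v, Measure (children G o v) := fun v => (PMF.uniformOfFintype _).toMeasure
    have hμ : ∀ v w, μ v {w} = (((children G o v).ncard : ℕ) : ℝ≥0∞)⁻¹ := by
      intro v w
      rw [PMF.toMeasure_apply_singleton _ _ (MeasurableSet.of_discrete),
        PMF.uniformOfFintype_apply, Set.ncard_eq_toFinset_card', Set.toFinset_card]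
    have hpre : ∀ x, ∃ (s : Finset V) (t : ∀ v, Set (children G o v)),
        (ofChoice hc) ⁻¹' (sector G o x) = Set.pi s t ∧
        ∏ v ∈ s, μ v (t v) = sphereWeight q (G.dist o x) := by
      intro x
      obtain ⟨s, t, -, hst, hp⟩ := setOf_ofChoice_eq hG μ hμ _ x rfl
      refine ⟨s, t, ?_, hp⟩
      rw [← hst]
      ext y
      exact mem_sector_iff hc x _
    have hmeas : Measurable (ofChoice (G := G) (o := o) hc) := by
      refine measurable_generateFrom ?_
      rintro _ ⟨x, rfl⟩
      obtain ⟨s, t, hst, -⟩ := hpre x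
      rw [hst]
      exact MeasurableSet.pi s.countable_toSet fun v _ => MeasurableSet.of_discrete
    refine ⟨(Measure.infinitePi μ).map (ofChoice hc), fun x => ?_⟩
    obtain ⟨s, t, hst, hp⟩ := hpre x
    rw [Measure.map_apply hmeas (MeasurableSpace.measurableSet_generateFrom ⟨x, rfl⟩), hst,
      Measure.infinitePi_pi _ fun v _ => MeasurableSet.of_discrete, hp]
  · intro ν ν' hν hν'
    have : IsFiniteMeasure ν := ⟨by rw [huniv ν hν]; simp⟩
    refine ext_of_generate_finite _ rfl (isPiSystem_sector hG.isTree) ?_ ?_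
    · rintro _ ⟨x, rfl⟩
      rw [hν, hν']
    · rw [huniv ν hν, huniv ν' hν']

/-- The probability measure `ν` on `Ω`, determined by its values on the sectors. -/
noncomputable def measure (hG : IsHomogeneousTree G q) (o : V) : Measure (TreeBoundary G o) :=
  (existsUnique_measure hG o).choose

theorem measure_sector (hG : IsHomogeneousTree G q) (o x : V) :
    measure hG o (sector G o x) = sphereWeight q (G.dist o x) :=
  (existsUnique_measure hG o).choose_spec.1 x

/-- The Poisson kernel `p(x, ω) = q ^ (2 |c(x, ω)| - |x|)`. -/
noncomputable def poissonKernel (q : ℕ) (x : V) (ω : TreeBoundary G o) : ℝ :=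
  (q : ℝ) ^ (2 * (G.dist o (confluence x ω) : ℤ) - (G.dist o x : ℤ))

/-- The Poisson transform `𝒫_z F(x) = ∫ p(x, ω) ^ (1/2 + i z) F(ω) dν(ω)`. -/
noncomputable def poissonTransform (hG : IsHomogeneousTree G q) (o : V) (z : ℂ)
    (F : TreeBoundary G o → ℂ) (x : V) : ℂ :=
  ∫ ω, (poissonKernel q x ω : ℂ) ^ (1 / 2 + Complex.I * z) * F ω ∂(measure hG o)

/-- The elementary spherical function `φ_z = 𝒫_z 1`. -/
noncomputable def sphericalFunction (hG : IsHomogeneousTree G q) (o : V) (z : ℂ) (x : V) : ℂ :=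
  poissonTransform hG o z (fun _ => 1) x

/-- `δ_p = 1/p - 1/2`; for the conjugate exponent `p'` one has `δ_{p'} = -δ_p`. -/
noncomputable def hardyDelta (p : ℝ) : ℝ := 1 / p - 1 / 2

/-- `(∫_K |u(k · x)|^r dk)^{1/r}` for `|x| = n` and `r < ∞`: the `L^r` mean of `u` over the sphere
`S(o, n)`, as `∫_K v(k · x) dk` is the average of `v` over that sphere. -/
noncomputable def sphericalMean (G : SimpleGraph V) (q : ℕ) (o : V) (r : ℝ) (u : V → ℂ) (n : ℕ) :
    ℝ≥0∞ :=
  (sphereWeight q n * ∑' y : {y : V // G.dist o y = n}, ‖u y‖ₑ ^ r) ^ (1 / r)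

/-- The Hardy-type norm `‖u‖_{ℋ^r_p(𝒳)}`, with values in `[0, ∞]`. The spherical function
`φ_{iδ_p}` is positive and radial; `φ_{iδ_p}(n)` is its value at the `n`-th vertex of the fixed
reference ray `ω₀`. -/
noncomputable def hardyNorm (hG : IsHomogeneousTree G q) (o : V) (ω₀ : TreeBoundary G o)
    (p : ℝ) (r : ℝ≥0∞) (u : V → ℂ) : ℝ≥0∞ :=
  if r = ∞ then
    ⨆ x : V, ‖sphericalFunction hG o (Complex.I * hardyDelta p) x‖ₑ⁻¹ * ‖u x‖ₑ
  else
    ⨆ n : ℕ, ‖sphericalFunction hG o (Complex.I * hardyDelta p) (ω₀.vertex n)‖ₑ⁻¹ *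
      sphericalMean G q o r.toReal u n

end TreeBoundary

/-!
Along a ray, the confluence of `ω_n` with a second ray is at least `i` exactly on the sector
`E(ω_i)`, so summation by parts turns `𝒫_z F(ω_n)` into `q ^ (-n (1/2 + iz))` times a weighted sum
of the conditional expectations `𝔼[F | ω_0, …, ω_i]`, `i ≤ n`, the weights depending only on
`a = q ^ (2iz)`. The case `F = 1` shows that `φ_z(n)` is the same factor times the total weight.

Upper bound: `|𝒫_z F|` is at most `𝒫_{i Im z} |F|`, for which the weights are nonnegative, so
the contractivity of conditional expectations on `L^r` bounds the norm over the sphere of radius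
`n` by `φ_{i Im z}(n) ‖F‖_r`. With `Im z = -δ_p` this factor is `φ_{iδ_p}(n)`, as `φ_{-z} = φ_z`.

Lower bound: martingale convergence and the regularity of the weighted means give
`𝒫_z F(ω_n) / φ_z(n) → F(ω)` almost everywhere, and Fatou's lemma concludes provided that
`|φ_z(n)|` is eventually at least `C φ_{iδ_p}(n)`. For `p < 2` this is read off the closed form of
the geometric sum of the weights, since `|a| > 1`; for `p = 2` one has `a = 1` and
`|φ_z(n)| = φ_0(n)`.
-/

section

open Filter Topology Asymptotics

theorem tendsto_inv_sum_smul_sum {𝕜 E : Type*} [NormedField 𝕜] [NormedAddCommGroup E]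
    [NormedSpace 𝕜 E] {w : ℕ → 𝕜} {g : ℕ → ℝ} {m : ℕ → E} {l : E} (hg : 0 ≤ g)
    (hwg : w =O[atTop] g) (hg_top : Tendsto (fun n => ∑ i ∈ Finset.range n, g i) atTop atTop)
    (hgw : (fun n => ∑ i ∈ Finset.range n, g i) =O[atTop] fun n => ∑ i ∈ Finset.range n, w i)
    (hm : Tendsto m atTop (𝓝 l)) :
    Tendsto (fun n => (∑ i ∈ Finset.range n, w i)⁻¹ • ∑ i ∈ Finset.range n, w i • m i)
      atTop (𝓝 l) := by
  have herror : (fun n => ∑ i ∈ Finset.range n, w i • (m i - l)) =o[atTop]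
      fun n => ∑ i ∈ Finset.range n, w i := by
    refine (IsLittleO.sum_range ?_ hg hg_top).trans_isBigO hgw
    simpa using hwg.smul_isLittleO ((isLittleO_one_iff ℝ).2 (tendsto_sub_nhds_zero_iff.2 hm))
  have hw_ne : ∀ᶠ n in atTop, ∑ i ∈ Finset.range n, w i ≠ 0 := by
    filter_upwards [hgw.eq_zero_imp, hg_top.eventually_gt_atTop 0] with n hn hpos hzero
    exact hpos.ne' (hn hzero)
  rw [← tendsto_sub_nhds_zero_iff]
  refine herror.tendsto_inv_smul_nhds_zero.congr' ?_
  filter_upwards [hw_ne] with n hn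
  simp only [smul_sub, Finset.sum_sub_distrib, ← Finset.sum_smul, inv_smul_smul₀ hn]

theorem tendsto_ae_condExp_of_finiteDimensional {Ω E : Type*} {m0 : MeasurableSpace Ω}
    {μ : Measure Ω} [IsFiniteMeasure μ] [NormedAddCommGroup E] [NormedSpace ℝ E]
    [FiniteDimensional ℝ E] {ℱ : Filtration ℕ m0} {f : Ω → E} (hf : Integrable f μ) :
    haveI := FiniteDimensional.complete ℝ E
    ∀ᵐ ω ∂μ, Tendsto (fun n => (μ[f | ℱ n]) ω) atTop (𝓝 ((μ[f | ⨆ n, ℱ n]) ω)) := by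
  have := FiniteDimensional.complete ℝ E
  let e := (Module.finBasis ℝ E).equivFunL
  let coord (j : Fin (Module.finrank ℝ E)) : E →L[ℝ] ℝ :=
    (ContinuousLinearMap.proj j).comp e.toContinuousLinearMap
  have hcoord (j) (m : MeasurableSpace Ω) :
      ∀ᵐ ω ∂μ, coord j ((μ[f | m]) ω) = (μ[coord j ∘ f | m]) ω :=
    (coord j).comp_condExp_comm hf
  have hlim (j) : ∀ᵐ ω ∂μ, Tendsto (fun n => coord j ((μ[f | ℱ n]) ω)) atTop
      (𝓝 (coord j ((μ[f | ⨆ n, ℱ n]) ω))) := by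
    filter_upwards [tendsto_ae_condExp (coord j ∘ f), hcoord j (⨆ n, ℱ n),
      ae_all_iff.2 fun n => hcoord j (ℱ n)] with ω hω hcoord_iSup hcoord_seq
    simpa only [hcoord_iSup, hcoord_seq] using hω
  filter_upwards [ae_all_iff.2 hlim] with ω hω
  have htuple : Tendsto (fun n => e ((μ[f | ℱ n]) ω)) atTop (𝓝 (e ((μ[f | ⨆ n, ℱ n]) ω))) :=
    tendsto_pi_nhds.2 hω
  simpa [Function.comp_def] using (e.symm.continuous.tendsto _).comp htuple

theorem setIntegral_preimage_singleton_eq_smul_condExp {Ω β E : Type*} {mΩ : MeasurableSpace Ω}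
    [mβ : MeasurableSpace β] [MeasurableSingletonClass β] {μ : Measure Ω} [IsFiniteMeasure μ]
    [NormedAddCommGroup E] [NormedSpace ℝ E] [CompleteSpace E] {X : Ω → β} (hX : Measurable X)
    {f : Ω → E} (hf : Integrable f μ) (ω : Ω) :
    ∫ ω' in X ⁻¹' {X ω}, f ω' ∂μ = μ.real (X ⁻¹' {X ω}) • (μ[f | mβ.comap X]) ω := by
  have hconst : ∀ ω' ∈ X ⁻¹' {X ω}, (μ[f | mβ.comap X]) ω' = (μ[f | mβ.comap X]) ω :=
    fun _ hω' => (StronglyMeasurable.factorsThrough stronglyMeasurable_condExp) hω'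
  rw [← setIntegral_condExp hX.comap_le hf ⟨_, measurableSet_singleton _, rfl⟩,
    setIntegral_congr_fun (hX (measurableSet_singleton _)) hconst, setIntegral_const]

theorem eLpNorm_sum_smul_condExp_le {Ω ι 𝕜 E : Type*} {m0 : MeasurableSpace Ω} {μ : Measure Ω}
    [NormedField 𝕜] [NormedAddCommGroup E] [NormedSpace ℝ E] [CompleteSpace E] [NormedSpace 𝕜 E]
    {r : ℝ≥0∞} (hr : 1 ≤ r) (s : Finset ι) (c : ι → 𝕜) (m : ι → MeasurableSpace Ω) (f : Ω → E) :
    eLpNorm (∑ i ∈ s, c i • μ[f | m i]) r μ ≤ (∑ i ∈ s, ‖c i‖ₑ) * eLpNorm f r μ := by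
  have hmeas (i : ι) : AEStronglyMeasurable (μ[f | m i]) μ :=
    integrable_condExp.aestronglyMeasurable
  calc eLpNorm (∑ i ∈ s, c i • μ[f | m i]) r μ
      ≤ ∑ i ∈ s, eLpNorm (c i • μ[f | m i]) r μ :=
        eLpNorm_sum_le (fun i _ => (hmeas i).const_smul (c i)) hr
    _ = ∑ i ∈ s, ‖c i‖ₑ * eLpNorm (μ[f | m i]) r μ := by simp only [eLpNorm_const_smul]
    _ ≤ ∑ i ∈ s, ‖c i‖ₑ * eLpNorm f r μ := by
        gcongr with i
        exact eLpNorm_condExp_le_eLpNorm f hr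
    _ = (∑ i ∈ s, ‖c i‖ₑ) * eLpNorm f r μ := by rw [Finset.sum_mul]

theorem eq_of_dist_add_dist_eq_of_isTree {V : Type*} {G : SimpleGraph V} (hG : G.IsTree)
    {o x x' y : V} (hx : G.dist o x + G.dist x y = G.dist o y)
    (hx' : G.dist o x' + G.dist x' y = G.dist o y) (h : G.dist o x = G.dist o x') : x = x' := by
  have hwalk (v : V) (hv : G.dist o v + G.dist v y = G.dist o y) :
      ∃ p : G.Walk o y, p.IsPath ∧ p.getVert (G.dist o v) = v := by
    obtain ⟨p₁, hp₁⟩ := hG.connected.exists_walk_length_eq_dist o v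
    obtain ⟨p₂, hp₂⟩ := hG.connected.exists_walk_length_eq_dist v y
    refine ⟨p₁.append p₂, SimpleGraph.Walk.isPath_of_length_eq_dist _ ?_, ?_⟩
    · rw [SimpleGraph.Walk.length_append, hp₁, hp₂, hv]
    · simp [SimpleGraph.Walk.getVert_append, hp₁]
  obtain ⟨p, hp, hpx⟩ := hwalk x hx
  obtain ⟨p', hp', hpx'⟩ := hwalk x' hx'
  rw [← hpx, ← hpx', (hG.existsUnique_path o y).unique hp hp', h]

end

namespace TreeBoundary

open Filter Topology

variable {V : Type*} {G : SimpleGraph V} {o : V} {q : ℕ}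

/-! ### Rays and the vertex filtration -/

theorem dist_confluence_vertex_le (ω ω' : TreeBoundary G o) (n : ℕ) :
    G.dist o (confluence (ω.vertex n) ω') ≤ n := by
  unfold confluence
  rw [dist_vertex]
  refine csSup_le ⟨0, by simp [ω'.vertex_zero]⟩ fun j hj => ?_
  simp only [Set.mem_ofPred_eq, dist_vertex] at hj
  omega

theorem sectorFrom_vertex (hG : G.IsTree) (ω : TreeBoundary G o) {i n : ℕ} (hi : i ≤ n) :
    sectorFrom G o i (ω.vertex n) = sector G o (ω.vertex i) := by
  ext ω'
  rw [mem_sector_iff hG.connected, dist_vertex]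
  change i ≤ G.dist o (confluence (ω.vertex n) ω') ↔ _
  rw [confluence, dist_vertex]
  set S : Set ℕ := {j | G.dist o (ω'.vertex j) + G.dist (ω'.vertex j) (ω.vertex n) =
    G.dist o (ω.vertex n)} with hS
  have hmem {j : ℕ} : j ∈ S ↔ j + G.dist (ω'.vertex j) (ω.vertex n) = n := by
    rw [hS, Set.mem_ofPred_eq, dist_vertex, dist_vertex]
  have hbdd : BddAbove S := ⟨n, fun j hj => by have := hmem.1 hj; omega⟩
  have hvertex {j : ℕ} (hj : j ≤ n) : j + G.dist (ω.vertex j) (ω.vertex n) = n := by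
    obtain ⟨k, rfl⟩ := Nat.exists_eq_add_of_le hj
    rw [ω.geodesic]
  constructor
  · intro h
    have hsup : sSup S ∈ S := Nat.sSup_mem ⟨0, hmem.2 (by
      rw [ω'.vertex_zero, zero_add, dist_vertex])⟩ hbdd
    have hle : sSup S ≤ n := by have := hmem.1 hsup; omega
    refine vertex_eq_of_le hG ?_ h
    exact eq_of_dist_add_dist_eq_of_isTree hG hsup
      (by simpa only [dist_vertex] using hvertex hle) (by simp only [dist_vertex])
  · intro h
    exact le_csSup hbdd (hmem.2 (h ▸ hvertex hi))

theorem apply_dist_confluence_vertex_eq_sum {A : Type*} [AddCommGroup A] (hG : G.IsTree)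
    (κ : ℕ → A) (ω ω' : TreeBoundary G o) (n : ℕ) :
    κ (G.dist o (confluence (ω.vertex n) ω')) = κ 0 + ∑ i ∈ Finset.range n,
      (sector G o (ω.vertex (i + 1))).indicator (fun _ => κ (i + 1) - κ i) ω' := by
  classical
  have hterm : ∀ i ∈ Finset.range n,
      (sector G o (ω.vertex (i + 1))).indicator (fun _ => κ (i + 1) - κ i) ω' =
        if i ∈ Finset.range (G.dist o (confluence (ω.vertex n) ω'))
          then κ (i + 1) - κ i else 0 := by
    intro i hi
    rw [← sectorFrom_vertex hG ω (Finset.mem_range.1 hi), Set.indicator_apply]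
    exact if_congr Finset.mem_range.symm rfl rfl
  rw [Finset.sum_congr rfl hterm, Finset.sum_ite_mem,
    Finset.inter_eq_right.2 (Finset.range_mono (dist_confluence_vertex_le ω ω' n)),
    Finset.sum_range_sub, add_sub_cancel]

theorem finite_sphere (hG : IsHomogeneousTree G q) (o : V) (n : ℕ) :
    {x | G.dist o x = n}.Finite := by
  induction n with
  | zero =>
    exact (Set.finite_singleton o).subset fun x hx =>
      (hG.isTree.connected.dist_eq_zero_iff.1 hx).symm
  | succ n ih =>
    refine (ih.biUnion fun v _ => finite_children (o := o) hG v).subset fun x hx => ?_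
    obtain ⟨u, hux, hu⟩ := exists_parent hG.isTree.connected hx
    exact Set.mem_biUnion hu ⟨hux, by rw [hu]; exact hx⟩

theorem _root_.IsHomogeneousTree.countable (hG : IsHomogeneousTree G q) : Countable V := by
  obtain ⟨o⟩ := hG.isTree.connected.nonempty
  refine Set.countable_univ_iff.1 <|
    (Set.countable_iUnion fun n => (finite_sphere hG o n).countable).mono fun x _ => ?_
  exact Set.mem_iUnion.2 ⟨G.dist o x, rfl⟩

theorem measurableSet_sector (x : V) : MeasurableSet (sector G o x) :=
  MeasurableSpace.measurableSet_generateFrom ⟨x, rfl⟩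

theorem vertex_preimage_singleton (hG : G.Connected) (n : ℕ) (x : V) :
    (fun ω : TreeBoundary G o => ω.vertex n) ⁻¹' {x} =
      if G.dist o x = n then sector G o x else ∅ := by
  ext ω
  split_ifs with hx
  · rw [mem_sector_iff hG, hx]
    rfl
  · exact iff_of_false (fun h => hx (h ▸ dist_vertex ω n)) (Set.notMem_empty ω)

theorem vertex_preimage_singleton_vertex (hG : G.Connected) (n : ℕ) (ω : TreeBoundary G o) :
    (fun ω' : TreeBoundary G o => ω'.vertex n) ⁻¹' {ω.vertex n} = sector G o (ω.vertex n) := by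
  rw [vertex_preimage_singleton hG, if_pos (dist_vertex ω n)]

theorem measurable_vertex (hG : IsHomogeneousTree G q) (n : ℕ) :
    Measurable[_, ⊤] fun ω : TreeBoundary G o => ω.vertex n := by
  have := hG.countable
  let _ : MeasurableSpace V := ⊤
  refine measurable_to_countable' fun x => ?_
  rw [vertex_preimage_singleton hG.isTree.connected]
  split_ifs
  exacts [measurableSet_sector x, MeasurableSet.empty]

/-- The filtration of `Ω` whose `n`-th σ-algebra is generated by the `n`-th vertex of the ray, that
is, by the sectors `E(x)` with `|x| = n`. -/
def vertexFiltration (hG : IsHomogeneousTree G q) (o : V) :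
    Filtration ℕ (inferInstance : MeasurableSpace (TreeBoundary G o)) where
  seq n := MeasurableSpace.comap (fun ω => ω.vertex n) ⊤
  mono' i j hij := by
    rintro _ ⟨s, -, rfl⟩
    refine ⟨(fun ω : TreeBoundary G o => ω.vertex j) '' ((fun ω => ω.vertex i) ⁻¹' s), trivial, ?_⟩
    refine (Set.subset_preimage_image _ _).antisymm' ?_
    rintro ω ⟨ω', hω', hj⟩
    have hi : ω'.vertex i = ω.vertex i := vertex_eq_of_le hG.isTree hj hij
    exact show ω.vertex i ∈ s from hi ▸ hω'
  le' n := (measurable_vertex hG n).comap_le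

theorem iSup_vertexFiltration (hG : IsHomogeneousTree G q) (o : V) :
    ⨆ n, vertexFiltration hG o n = (inferInstance : MeasurableSpace (TreeBoundary G o)) := by
  refine le_antisymm (iSup_le (vertexFiltration hG o).le) (MeasurableSpace.generateFrom_le ?_)
  rintro _ ⟨x, rfl⟩
  refine le_iSup (fun n => vertexFiltration hG o n) (G.dist o x) _ ⟨{x}, trivial, ?_⟩
  rw [vertex_preimage_singleton hG.isTree.connected, if_pos rfl]

instance isProbabilityMeasure_measure (hG : IsHomogeneousTree G q) (o : V) :
    IsProbabilityMeasure (measure hG o) where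
  measure_univ := by
    rw [← sector_self hG.isTree.connected, measure_sector, SimpleGraph.dist_self, sphereWeight,
      if_pos rfl]

theorem sphereWeight_ne_zero (q n : ℕ) : sphereWeight q n ≠ 0 := by
  unfold sphereWeight
  split_ifs
  · exact one_ne_zero
  · exact ENNReal.inv_ne_zero.2 (by finiteness)

theorem toReal_sphereWeight_succ (q n : ℕ) :
    (sphereWeight q (n + 1)).toReal = (((q : ℝ) + 1) * (q : ℝ) ^ n)⁻¹ := by
  rw [sphereWeight, if_neg n.succ_ne_zero, Nat.add_sub_cancel, ENNReal.toReal_inv]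
  norm_cast

theorem measure_vertex_preimage_singleton (hG : IsHomogeneousTree G q) (n : ℕ) (x : V) :
    measure hG o ((fun ω => ω.vertex n) ⁻¹' {x}) =
      {y | G.dist o y = n}.indicator (fun _ => sphereWeight q n) x := by
  rw [vertex_preimage_singleton hG.isTree.connected, Set.indicator_apply]
  simp only [Set.mem_ofPred_eq]
  split_ifs with hx
  · rw [measure_sector, hx]
  · exact measure_empty

theorem lintegral_vertex (hG : IsHomogeneousTree G q) (n : ℕ) (g : V → ℝ≥0∞) :
    ∫⁻ ω, g (ω.vertex n) ∂(measure hG o) =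
      sphereWeight q n * ∑' y : {y : V // G.dist o y = n}, g y := by
  have := hG.countable
  let _ : MeasurableSpace V := ⊤
  rw [← lintegral_map (f := g) .of_discrete (measurable_vertex hG n), lintegral_countable',
    ← ENNReal.tsum_mul_left]
  refine Eq.trans (tsum_congr fun y => ?_)
    (tsum_subtype {y | G.dist o y = n} fun y => sphereWeight q n * g y).symm
  rw [Measure.map_apply (measurable_vertex hG n) .of_discrete,
    measure_vertex_preimage_singleton hG, mul_comm, ← Set.indicator_mul_left]

theorem setIntegral_sector_vertex {E : Type*} [NormedAddCommGroup E] [NormedSpace ℝ E]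
    [CompleteSpace E] (hG : IsHomogeneousTree G q) {F : TreeBoundary G o → E}
    (hF : Integrable F (measure hG o)) (n : ℕ) (ω : TreeBoundary G o) :
    ∫ ω' in sector G o (ω.vertex n), F ω' ∂(measure hG o) =
      (sphereWeight q n).toReal • ((measure hG o)[F | vertexFiltration hG o n]) ω := by
  let _ : MeasurableSpace V := ⊤
  have h := setIntegral_preimage_singleton_eq_smul_condExp (measurable_vertex hG n) hF ω
  rwa [vertex_preimage_singleton_vertex hG.isTree.connected, Measure.real, measure_sector,
    dist_vertex] at h

theorem tendsto_ae_condExp_vertexFiltration {E : Type*} [NormedAddCommGroup E] [NormedSpace ℝ E]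
    [FiniteDimensional ℝ E] (hG : IsHomogeneousTree G q) {F : TreeBoundary G o → E}
    (hF : Integrable F (measure hG o)) :
    haveI := FiniteDimensional.complete ℝ E
    ∀ᵐ ω ∂(measure hG o), Tendsto
      (fun n => ((measure hG o)[F | vertexFiltration hG o n]) ω) atTop (𝓝 (F ω)) := by
  have := FiniteDimensional.complete ℝ E
  have hlimit : (measure hG o)[F | ⨆ n, vertexFiltration hG o n] =ᵐ[measure hG o] F := by
    rw [iSup_vertexFiltration]
    exact condExp_of_aestronglyMeasurable' le_rfl hF.aestronglyMeasurable hF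
  filter_upwards [tendsto_ae_condExp_of_finiteDimensional (ℱ := vertexFiltration hG o) hF, hlimit]
    with ω hω heq
  rwa [heq] at hω

theorem integral_dist_confluence_smul {𝕜 E : Type*} [RCLike 𝕜] [NormedAddCommGroup E]
    [NormedSpace ℝ E] [NormedSpace 𝕜 E] [IsScalarTower ℝ 𝕜 E] [CompleteSpace E]
    (hG : IsHomogeneousTree G q) (κ : ℕ → 𝕜) {F : TreeBoundary G o → E}
    (hF : Integrable F (measure hG o)) (ω : TreeBoundary G o) (n : ℕ) :
    ∫ ω', κ (G.dist o (confluence (ω.vertex n) ω')) • F ω' ∂(measure hG o) =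
      κ 0 • ((measure hG o)[F | vertexFiltration hG o 0]) ω +
        ∑ i ∈ Finset.range n, ((κ (i + 1) - κ i) * (((q : 𝕜) + 1) * (q : 𝕜) ^ i)⁻¹) •
          ((measure hG o)[F | vertexFiltration hG o (i + 1)]) ω := by
  let S (i : ℕ) : Set (TreeBoundary G o) := sector G o (ω.vertex i)
  have hS (i : ℕ) : MeasurableSet (S i) := measurableSet_sector _
  have hkernel (ω' : TreeBoundary G o) :
      κ (G.dist o (confluence (ω.vertex n) ω')) • F ω' =
        κ 0 • F ω' + ∑ i ∈ Finset.range n, (κ (i + 1) - κ i) • (S (i + 1)).indicator F ω' := by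
    rw [apply_dist_confluence_vertex_eq_sum hG.isTree κ, add_smul, Finset.sum_smul]
    congr! 2 with i
    by_cases hmem : ω' ∈ S (i + 1)
    · rw [Set.indicator_of_mem hmem, Set.indicator_of_mem hmem]
    · rw [Set.indicator_of_notMem hmem, Set.indicator_of_notMem hmem, zero_smul, smul_zero]
  have hint (i : ℕ) : ∫ ω', (S i).indicator F ω' ∂(measure hG o) =
      (sphereWeight q i).toReal • ((measure hG o)[F | vertexFiltration hG o i]) ω := by
    rw [integral_indicator (hS i), setIntegral_sector_vertex hG hF]
  have hint_zero : ∫ ω', F ω' ∂(measure hG o) =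
      ((measure hG o)[F | vertexFiltration hG o 0]) ω := by
    simpa [S, ω.vertex_zero, sector_self hG.isTree.connected, sphereWeight] using hint 0
  have hS_int (i : ℕ) : Integrable (fun ω' => (κ (i + 1) - κ i) • (S (i + 1)).indicator F ω')
      (measure hG o) := (hF.indicator (hS _)).smul _
  simp_rw [hkernel]
  rw [integral_add (by exact hF.smul _) (integrable_finsetSum _ fun i _ => hS_int i),
    integral_finsetSum _ fun i _ => hS_int i]
  simp_rw [integral_smul, hint_zero, hint, toReal_sphereWeight_succ]
  congr! 2 with i
  rw [← algebraMap_smul 𝕜 (((q : ℝ) + 1) * (q : ℝ) ^ i)⁻¹, smul_smul]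
  simp

/-! ### Spherical sums -/

/-- The coefficients of the conditional expectations `𝔼[F | vertexFiltration i]` in the expansion of
`𝒫_z F` along a ray, where `a = q ^ (2iz)`, up to the common factor `q ^ (-n (1/2 + iz))` at level
`n`. -/
def sphericalWeight {K : Type*} [Field K] (q : ℕ) (a : K) : ℕ → K
  | 0 => 1
  | i + 1 => (q * a - 1) / (q + 1) * a ^ i

/-- The total weight up to level `n`: the value of `φ_z` on the sphere of radius `n`, where
`a = q ^ (2iz)`, up to the factor `q ^ (-n (1/2 + iz))`. -/
def sphericalSum {K : Type*} [Field K] (q : ℕ) (a : K) (n : ℕ) : K :=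
  ∑ i ∈ Finset.range (n + 1), sphericalWeight q a i

section Field

variable {K : Type*} [Field K]

theorem sphericalSum_zero (q : ℕ) (a : K) : sphericalSum q a 0 = 1 := by
  simp [sphericalSum, sphericalWeight]

theorem sphericalSum_succ (q : ℕ) (a : K) (n : ℕ) :
    sphericalSum q a (n + 1) = sphericalSum q a n + (q * a - 1) / (q + 1) * a ^ n :=
  Finset.sum_range_succ _ _

theorem sphericalSum_succ' (hq : (q : K) + 1 ≠ 0) (a : K) (n : ℕ) :
    sphericalSum q a (n + 1) = a * sphericalSum q a n + (q - a) / (q + 1) := by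
  induction n with
  | zero =>
    rw [sphericalSum_succ, sphericalSum_zero]
    field_simp
    ring
  | succ n ih =>
    linear_combination sphericalSum_succ q a (n + 1) + ih - a * sphericalSum_succ q a n

theorem sphericalSum_inv_mul_pow (hq : (q : K) + 1 ≠ 0) {a : K} (ha : a ≠ 0) (n : ℕ) :
    sphericalSum q a⁻¹ n * a ^ n = sphericalSum q a n := by
  induction n with
  | zero => simp only [sphericalSum_zero, pow_zero, mul_one]
  | succ n ih =>
    rw [sphericalSum_succ q a, sphericalSum_succ' hq, ← ih]
    field_simp
    ring

theorem mul_sphericalSum (hq : (q : K) + 1 ≠ 0) (a : K) (n : ℕ) :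
    (q + 1) * (a - 1) * sphericalSum q a n = a ^ n * (q * a - 1) - (q - a) := by
  induction n with
  | zero =>
    rw [sphericalSum_zero]
    ring
  | succ n ih =>
    rw [sphericalSum_succ, mul_add, ih]
    field_simp
    ring

end Field

section Real

variable {A : ℝ}

theorem sphericalWeight_nonneg (hA : 0 ≤ A) (hqA : 1 ≤ q * A) : ∀ i, 0 ≤ sphericalWeight q A i
  | 0 => zero_le_one
  | i + 1 => mul_nonneg (div_nonneg (sub_nonneg.2 hqA) (by positivity)) (by positivity)

theorem sphericalSum_pos (hA : 0 ≤ A) (hqA : 1 ≤ q * A) (n : ℕ) : 0 < sphericalSum q A n := by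
  rw [sphericalSum, Finset.sum_range_succ']
  exact add_pos_of_nonneg_of_pos
    (Finset.sum_nonneg fun i _ => sphericalWeight_nonneg hA hqA (i + 1)) one_pos

theorem one_third_le_sphericalWeight (hq : 2 ≤ q) (hA : 1 ≤ A) :
    ∀ i, 1 / 3 ≤ sphericalWeight q A i
  | 0 => by norm_num [sphericalWeight]
  | i + 1 => by
    have hq' : (2 : ℝ) ≤ q := by exact_mod_cast hq
    have hcoeff : 1 / 3 ≤ (q * A - 1) / (q + 1) := by
      rw [div_le_div_iff₀ (by norm_num) (by positivity)]
      nlinarith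
    exact hcoeff.trans (le_mul_of_one_le_right (by linarith) (one_le_pow₀ hA))

theorem tendsto_sum_sphericalWeight_atTop (hq : 2 ≤ q) (hA : 1 ≤ A) :
    Tendsto (fun n => ∑ i ∈ Finset.range n, sphericalWeight q A i) atTop atTop := by
  refine tendsto_atTop_mono (fun n => ?_)
    (tendsto_natCast_atTop_atTop.atTop_mul_const (by norm_num : (0 : ℝ) < 1 / 3))
  simpa using Finset.card_nsmul_le_sum (Finset.range n) _ (1 / 3)
    fun i _ => one_third_le_sphericalWeight hq hA i

end Real

section RCLike

variable {𝕜 : Type*} [RCLike 𝕜] {a : 𝕜}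

theorem norm_natCast_add_one (q : ℕ) : ‖(q : 𝕜) + 1‖ = q + 1 := by
  exact_mod_cast RCLike.norm_natCast (K := 𝕜) (q + 1)

theorem norm_sphericalWeight_le (ha : 2 ≤ q * ‖a‖) :
    ∀ i, ‖sphericalWeight q a i‖ ≤ 3 * sphericalWeight q ‖a‖ i
  | 0 => by norm_num [sphericalWeight]
  | i + 1 => by
    have hnum : ‖(q : 𝕜) * a - 1‖ ≤ 3 * (q * ‖a‖ - 1) := by
      have := norm_sub_le ((q : 𝕜) * a) 1
      rw [norm_mul, RCLike.norm_natCast, norm_one] at this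
      linarith
    simp only [sphericalWeight, norm_mul, norm_div, norm_pow, norm_natCast_add_one]
    rw [← mul_assoc, ← mul_div_assoc]
    gcongr

theorem mul_norm_sphericalSum_ge (n : ℕ) :
    ‖a‖ ^ n * (q * ‖a‖ - 1) - (q + ‖a‖) ≤ (q + 1) * (‖a‖ + 1) * ‖sphericalSum q a n‖ := by
  have hclosed := mul_sphericalSum (q := q) (Nat.cast_add_one_ne_zero q) a n
  have hmain : ‖a‖ ^ n * (q * ‖a‖ - 1) ≤ ‖a ^ n * ((q : 𝕜) * a - 1)‖ := by
    have := norm_sub_norm_le ((q : 𝕜) * a) 1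
    rw [norm_mul, RCLike.norm_natCast, norm_one] at this
    rw [norm_mul, norm_pow]
    gcongr
  have hrest : ‖(q : 𝕜) - a‖ ≤ q + ‖a‖ := by
    simpa using norm_sub_le (q : 𝕜) a
  calc ‖a‖ ^ n * (q * ‖a‖ - 1) - (q + ‖a‖)
      ≤ ‖a ^ n * ((q : 𝕜) * a - 1)‖ - ‖(q : 𝕜) - a‖ := sub_le_sub hmain hrest
    _ ≤ ‖a ^ n * ((q : 𝕜) * a - 1) - (q - a)‖ := norm_sub_norm_le _ _
    _ = (q + 1) * ‖a - 1‖ * ‖sphericalSum q a n‖ := by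
        rw [← hclosed, norm_mul, norm_mul, norm_natCast_add_one]
    _ ≤ (q + 1) * (‖a‖ + 1) * ‖sphericalSum q a n‖ := by
        gcongr
        simpa using norm_sub_le a 1

theorem eventually_mul_sphericalSum_le_norm (hq : 1 ≤ q) {A₀ : ℝ} (hA₀ : 1 < A₀) (ha : A₀ ≤ ‖a‖) :
    ∀ᶠ n in atTop, (A₀ - 1) / (2 * (A₀ + 1)) * sphericalSum q ‖a‖ n ≤ ‖sphericalSum q a n‖ := by
  have hq' : (1 : ℝ) ≤ q := by exact_mod_cast hq
  have hqa : 1 < q * ‖a‖ := by nlinarith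
  have hgrowth : Tendsto (fun n : ℕ => ‖a‖ ^ n * (q * ‖a‖ - 1)) atTop atTop :=
    (tendsto_pow_atTop_atTop_of_one_lt (hA₀.trans_le ha)).atTop_mul_const (sub_pos.2 hqa)
  filter_upwards [hgrowth.eventually_ge_atTop (3 * (q + ‖a‖))] with n hn
  have hpos := sphericalSum_pos (norm_nonneg a) hqa.le n
  have hreal := mul_sphericalSum (K := ℝ) (q := q) (by positivity) ‖a‖ n
  have hnorm := mul_norm_sphericalSum_ge (q := q) (a := a) n
  have hcompare : (q + 1) * ((‖a‖ - 1) * sphericalSum q ‖a‖ n) ≤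
      (q + 1) * (2 * (‖a‖ + 1) * ‖sphericalSum q a n‖) := by linarith
  calc (A₀ - 1) / (2 * (A₀ + 1)) * sphericalSum q ‖a‖ n
      ≤ (‖a‖ - 1) / (2 * (‖a‖ + 1)) * sphericalSum q ‖a‖ n := by
        gcongr ?_ * _
        rw [div_le_div_iff₀ (by linarith) (by positivity)]
        nlinarith
    _ ≤ ‖sphericalSum q a n‖ := by
        rw [div_mul_eq_mul_div, div_le_iff₀' (by positivity)]
        exact le_of_mul_le_mul_left hcompare (by positivity)

theorem tendsto_inv_sphericalSum_smul_sum {E : Type*} [NormedAddCommGroup E] [NormedSpace 𝕜 E]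
    (hq : 2 ≤ q) (ha : 1 ≤ ‖a‖) {C : ℝ} (hC : 0 < C)
    (hlower : ∀ᶠ n in atTop, C * sphericalSum q ‖a‖ n ≤ ‖sphericalSum q a n‖)
    {m : ℕ → E} {l : E} (hm : Tendsto m atTop (𝓝 l)) :
    Tendsto (fun n => (sphericalSum q a n)⁻¹ •
      ∑ i ∈ Finset.range (n + 1), sphericalWeight q a i • m i) atTop (𝓝 l) := by
  have hqa : 2 ≤ q * ‖a‖ :=
    le_trans (by exact_mod_cast hq) (le_mul_of_one_le_right q.cast_nonneg ha)
  have hnonneg := sphericalWeight_nonneg (norm_nonneg a) (one_le_two.trans hqa)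
  refine (tendsto_add_atTop_iff_nat 1).2 <| tendsto_inv_sum_smul_sum hnonneg
    (.of_bound 3 (.of_forall fun i => ?_)) (tendsto_sum_sphericalWeight_atTop hq ha)
    (.of_bound C⁻¹ ?_) hm
  · rw [Real.norm_of_nonneg (hnonneg i)]
    exact norm_sphericalWeight_le hqa i
  · rw [← map_add_atTop_eq_nat 1, eventually_map]
    filter_upwards [hlower] with n hn
    rw [Real.norm_of_nonneg (Finset.sum_nonneg fun i _ => hnonneg i)]
    exact (le_inv_mul_iff₀ hC).2 hn

end RCLike

/-! ### Poisson transforms along a ray -/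

theorem _root_.IsHomogeneousTree.pos (hG : IsHomogeneousTree G q) : 0 < q :=
  two_pos.trans_le hG.two_le

theorem poissonKernel_pos (hq : 0 < q) (x : V) (ω : TreeBoundary G o) : 0 < poissonKernel q x ω :=
  zpow_pos (Nat.cast_pos.2 hq) _

theorem poissonKernel_cpow (hq : 0 < q) (s : ℂ) (x : V) (ω : TreeBoundary G o) :
    (poissonKernel q x ω : ℂ) ^ s =
      ((q : ℂ) ^ s) ^ (2 * (G.dist o (confluence x ω) : ℤ) - (G.dist o x : ℤ)) := by
  rw [Complex.cpow_def_of_ne_zero (by exact_mod_cast (poissonKernel_pos hq x ω).ne'),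
    Complex.cpow_def_of_ne_zero (by exact_mod_cast hq.ne'), ← Complex.exp_int_mul,
    ← Complex.ofReal_log (poissonKernel_pos hq x ω).le, ← Complex.natCast_log, poissonKernel,
    Real.log_zpow, Complex.ofReal_mul, Complex.ofReal_intCast, mul_assoc]

theorem norm_poissonTransform_le (hG : IsHomogeneousTree G q) (z : ℂ) (F : TreeBoundary G o → ℂ)
    (x : V) :
    ‖poissonTransform hG o z F x‖ ≤
      ‖poissonTransform hG o (Complex.I * z.im) (fun ω => (‖F ω‖ : ℂ)) x‖ := by
  have hpos : ∀ ω : TreeBoundary G o, 0 < poissonKernel q x ω := poissonKernel_pos hG.pos x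
  have hexponent : 1 / 2 + Complex.I * (Complex.I * z.im) =
      ((1 / 2 + Complex.I * z).re : ℂ) := by
    rw [← mul_assoc, Complex.I_mul_I]
    simp
  have hnorm (ω : TreeBoundary G o) :
      (poissonKernel q x ω : ℂ) ^ (1 / 2 + Complex.I * (Complex.I * z.im)) * (‖F ω‖ : ℂ) =
        (‖(poissonKernel q x ω : ℂ) ^ (1 / 2 + Complex.I * z) * F ω‖ : ℂ) := by
    rw [hexponent, norm_mul, Complex.norm_cpow_eq_rpow_re_of_pos (hpos ω), Complex.ofReal_mul,
      Complex.ofReal_cpow (hpos ω).le]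
  unfold poissonTransform
  simp_rw [hnorm]
  rw [integral_complex_ofReal, Complex.norm_real]
  exact (norm_integral_le_integral_norm _).trans (le_abs_self _)

theorem natCast_mul_cpow_two_mul_I_mul (hq : q ≠ 0) (z : ℂ) :
    (q : ℂ) * (q : ℂ) ^ (2 * Complex.I * z) = ((q : ℂ) ^ (1 / 2 + Complex.I * z)) ^ 2 := by
  have hq0 : (q : ℂ) ≠ 0 := Nat.cast_ne_zero.2 hq
  calc (q : ℂ) * (q : ℂ) ^ (2 * Complex.I * z)
      = (q : ℂ) ^ (1 + 2 * Complex.I * z) := by rw [Complex.cpow_add _ _ hq0, Complex.cpow_one]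
    _ = (q : ℂ) ^ ((1 / 2 + Complex.I * z) * (2 : ℕ)) := by
        push_cast
        ring_nf
    _ = ((q : ℂ) ^ (1 / 2 + Complex.I * z)) ^ 2 := Complex.cpow_mul_nat _ _ _

theorem poissonTransform_vertex (hG : IsHomogeneousTree G q) (z : ℂ) {F : TreeBoundary G o → ℂ}
    (hF : Integrable F (measure hG o)) (ω : TreeBoundary G o) (n : ℕ) :
    poissonTransform hG o z F (ω.vertex n) = ((q : ℂ) ^ (1 / 2 + Complex.I * z))⁻¹ ^ n *
      ∑ i ∈ Finset.range (n + 1), sphericalWeight q ((q : ℂ) ^ (2 * Complex.I * z)) i •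
        ((measure hG o)[F | vertexFiltration hG o i]) ω := by
  have hq0 : (q : ℂ) ≠ 0 := Nat.cast_ne_zero.2 hG.pos.ne'
  have hq1 : (q : ℂ) + 1 ≠ 0 := Nat.cast_add_one_ne_zero q
  have hsquare := natCast_mul_cpow_two_mul_I_mul hG.pos.ne' z
  set Q : ℂ := (q : ℂ) ^ (1 / 2 + Complex.I * z) with hQ
  set a : ℂ := (q : ℂ) ^ (2 * Complex.I * z)
  have hQ0 : Q ≠ 0 := by rw [hQ, Complex.cpow_ne_zero_iff]; exact .inl hq0
  let κ (j : ℕ) : ℂ := Q⁻¹ ^ n * (q * a) ^ j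
  have hkernel (ω' : TreeBoundary G o) :
      (poissonKernel q (ω.vertex n) ω' : ℂ) ^ (1 / 2 + Complex.I * z) * F ω' =
        κ (G.dist o (confluence (ω.vertex n) ω')) • F ω' := by
    rw [poissonKernel_cpow hG.pos, dist_vertex, ← hQ, zpow_sub₀ hQ0, zpow_mul, zpow_natCast,
      zpow_natCast, smul_eq_mul, div_eq_inv_mul, ← inv_pow]
    simp only [κ, hsquare]
    rfl
  simp_rw [poissonTransform, hkernel, integral_dist_confluence_smul hG κ hF]
  rw [Finset.sum_range_succ', mul_add, add_comm, Finset.mul_sum]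
  simp only [κ, sphericalWeight, smul_eq_mul, pow_zero, mul_one, one_mul]
  congr! 2 with i
  field_simp
  ring

theorem sphericalFunction_vertex (hG : IsHomogeneousTree G q) (z : ℂ) (ω : TreeBoundary G o)
    (n : ℕ) :
    sphericalFunction hG o z (ω.vertex n) = ((q : ℂ) ^ (1 / 2 + Complex.I * z))⁻¹ ^ n *
      sphericalSum q ((q : ℂ) ^ (2 * Complex.I * z)) n := by
  rw [sphericalFunction, poissonTransform_vertex hG z (integrable_const _)]
  simp_rw [condExp_const ((vertexFiltration hG o).le _), smul_eq_mul, mul_one]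
  rfl

theorem exists_vertex_eq_of_ae (hG : IsHomogeneousTree G q) (x : V) {P : TreeBoundary G o → Prop}
    (hP : ∀ᵐ ω ∂(measure hG o), P ω) : ∃ ω, P ω ∧ ω.vertex (G.dist o x) = x := by
  by_contra! h
  refine sphereWeight_ne_zero q (G.dist o x) ?_
  rw [← measure_sector hG]
  exact measure_mono_null (fun ω hω hPω => h ω hPω ((mem_sector_iff hG.isTree.connected x ω).1 hω))
    hP

theorem sphericalFunction_neg (hG : IsHomogeneousTree G q) (z : ℂ) (x : V) :
    sphericalFunction hG o (-z) x = sphericalFunction hG o z x := by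
  obtain ⟨ω, -, hω⟩ := exists_vertex_eq_of_ae (o := o) hG x (.of_forall fun _ => trivial)
  have hq0 : (q : ℂ) ≠ 0 := Nat.cast_ne_zero.2 hG.pos.ne'
  have ha : (q : ℂ) ^ (2 * Complex.I * z) ≠ 0 := (Complex.cpow_ne_zero_iff).2 (.inl hq0)
  have hprefactor : ((q : ℂ) ^ (1 / 2 + Complex.I * -z))⁻¹ =
      ((q : ℂ) ^ (1 / 2 + Complex.I * z))⁻¹ * (q : ℂ) ^ (2 * Complex.I * z) := by
    rw [← Complex.cpow_neg, ← Complex.cpow_neg, ← Complex.cpow_add _ _ hq0]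
    ring_nf
  rw [← hω, sphericalFunction_vertex, sphericalFunction_vertex, hprefactor, mul_neg,
    Complex.cpow_neg, ← sphericalSum_inv_mul_pow (Nat.cast_add_one_ne_zero q) ha, mul_pow]
  ring

theorem norm_natCast_cpow_two_mul_I_mul (hq : 0 < q) (z : ℂ) :
    ‖(q : ℂ) ^ (2 * Complex.I * z)‖ = (q : ℝ) ^ (-2 * z.im) := by
  rw [Complex.norm_natCast_cpow_of_pos hq]
  simp

theorem natCast_cpow_two_mul_I_mul_I_mul_im (hq : 0 < q) (z : ℂ) :
    (q : ℂ) ^ (2 * Complex.I * (Complex.I * z.im)) = (‖(q : ℂ) ^ (2 * Complex.I * z)‖ : ℂ) := by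
  rw [norm_natCast_cpow_two_mul_I_mul hq, Complex.ofReal_cpow q.cast_nonneg,
    ← mul_assoc, mul_assoc 2, Complex.I_mul_I]
  push_cast
  ring_nf

theorem norm_inv_natCast_cpow_half_add_I_mul_im (hq : 0 < q) (z : ℂ) :
    ‖((q : ℂ) ^ (1 / 2 + Complex.I * (Complex.I * z.im)))⁻¹‖ =
      ‖((q : ℂ) ^ (1 / 2 + Complex.I * z))⁻¹‖ := by
  rw [norm_inv, norm_inv, Complex.norm_natCast_cpow_of_pos hq, Complex.norm_natCast_cpow_of_pos hq]
  simp

theorem ofReal_sphericalWeight (q : ℕ) (A : ℝ) (i : ℕ) :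
    ((sphericalWeight q A i : ℝ) : ℂ) = sphericalWeight q (A : ℂ) i := by
  cases i <;> simp [sphericalWeight]

theorem ofReal_sphericalSum (q : ℕ) (A : ℝ) (n : ℕ) :
    ((sphericalSum q A n : ℝ) : ℂ) = sphericalSum q (A : ℂ) n := by
  simp_rw [sphericalSum, Complex.ofReal_sum, ofReal_sphericalWeight]

theorem sum_enorm_sphericalWeight {A : ℝ} (hA : 0 ≤ A) (hqA : 1 ≤ q * A) (n : ℕ) :
    ∑ i ∈ Finset.range (n + 1), ‖sphericalWeight q (A : ℂ) i‖ₑ = ‖sphericalSum q (A : ℂ) n‖ₑ := by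
  have henorm {t : ℝ} (ht : 0 ≤ t) : ‖(t : ℂ)‖ₑ = ENNReal.ofReal t := by
    rw [← ofReal_norm, Complex.norm_of_nonneg ht]
  have hnonneg := sphericalWeight_nonneg hA hqA
  simp_rw [← ofReal_sphericalSum, ← ofReal_sphericalWeight, henorm (hnonneg _),
    henorm (sphericalSum_pos hA hqA n).le, sphericalSum,
    ENNReal.ofReal_sum_of_nonneg fun i _ => hnonneg i]

theorem one_le_mul_norm_natCast_cpow (hq : 0 < q) {z : ℂ} (hz : z.im ≤ 1 / 2) :
    1 ≤ q * ‖(q : ℂ) ^ (2 * Complex.I * z)‖ := by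
  have hexponent : 0 ≤ (1 / 2 + Complex.I * z).re := by simpa using hz
  rw [← RCLike.norm_natCast (K := ℂ), ← norm_mul, natCast_mul_cpow_two_mul_I_mul hq.ne', norm_pow,
    Complex.norm_natCast_cpow_of_pos hq]
  exact one_le_pow₀ (Real.one_le_rpow (Nat.one_le_cast.2 hq) hexponent)

theorem norm_sphericalFunction_I_mul_im_vertex (hG : IsHomogeneousTree G q) {z : ℂ}
    (hz : z.im ≤ 1 / 2) (ω : TreeBoundary G o) (n : ℕ) :
    ‖sphericalFunction hG o (Complex.I * z.im) (ω.vertex n)‖ =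
      ‖((q : ℂ) ^ (1 / 2 + Complex.I * z))⁻¹‖ ^ n *
        sphericalSum q ‖(q : ℂ) ^ (2 * Complex.I * z)‖ n := by
  rw [sphericalFunction_vertex, natCast_cpow_two_mul_I_mul_I_mul_im hG.pos, ← ofReal_sphericalSum,
    norm_mul, norm_pow, norm_inv_natCast_cpow_half_add_I_mul_im hG.pos, Complex.norm_real,
    Real.norm_of_nonneg
      (sphericalSum_pos (norm_nonneg _) (one_le_mul_norm_natCast_cpow hG.pos hz) n).le]

theorem mul_norm_sphericalFunction_le_iff (hG : IsHomogeneousTree G q) {z : ℂ}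
    (hz : z.im ≤ 1 / 2) (C : ℝ) (ω : TreeBoundary G o) (n : ℕ) :
    C * ‖sphericalFunction hG o (Complex.I * z.im) (ω.vertex n)‖ ≤
        ‖sphericalFunction hG o z (ω.vertex n)‖ ↔
      C * sphericalSum q ‖(q : ℂ) ^ (2 * Complex.I * z)‖ n ≤
        ‖sphericalSum q ((q : ℂ) ^ (2 * Complex.I * z)) n‖ := by
  have hpos : 0 < ‖((q : ℂ) ^ (1 / 2 + Complex.I * z))⁻¹‖ ^ n := by
    have hq0 : (q : ℂ) ≠ 0 := Nat.cast_ne_zero.2 hG.pos.ne'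
    exact pow_pos (norm_pos_iff.2 (inv_ne_zero (Complex.cpow_ne_zero_iff.2 (.inl hq0)))) n
  rw [norm_sphericalFunction_I_mul_im_vertex hG hz, sphericalFunction_vertex, norm_mul, norm_pow,
    mul_left_comm, mul_le_mul_iff_right₀ hpos]

theorem eLpNorm_poissonTransform_vertex_le (hG : IsHomogeneousTree G q) {z : ℂ}
    (hz : z.im ≤ 1 / 2) {r : ℝ≥0∞} (hr : 1 ≤ r) {F : TreeBoundary G o → ℂ}
    (hF : Integrable F (measure hG o)) (ω₀ : TreeBoundary G o) (n : ℕ) :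
    eLpNorm (fun ω : TreeBoundary G o => poissonTransform hG o z F (ω.vertex n)) r (measure hG o) ≤
      ‖sphericalFunction hG o (Complex.I * z.im) (ω₀.vertex n)‖ₑ * eLpNorm F r (measure hG o) := by
  let Q : ℂ := ((q : ℂ) ^ (1 / 2 + Complex.I * (Complex.I * z.im)))⁻¹
  let A : ℝ := ‖(q : ℂ) ^ (2 * Complex.I * z)‖
  let normF : TreeBoundary G o → ℂ := fun ω => ‖F ω‖
  have hnormF : Integrable normF (measure hG o) := hF.norm.ofReal
  have hnormF_eLpNorm : eLpNorm normF r (measure hG o) = eLpNorm F r (measure hG o) :=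
    eLpNorm_congr_norm_ae (.of_forall fun ω => by simp [normF])
  have hexpand : (fun ω : TreeBoundary G o =>
      poissonTransform hG o (Complex.I * z.im) normF (ω.vertex n)) =
        Q ^ n • ∑ i ∈ Finset.range (n + 1), sphericalWeight q (A : ℂ) i •
          (measure hG o)[normF | vertexFiltration hG o i] := by
    ext ω
    rw [poissonTransform_vertex hG _ hnormF, natCast_cpow_two_mul_I_mul_I_mul_im hG.pos]
    simp only [Pi.smul_apply, Finset.sum_apply, smul_eq_mul, Q, A]
  calc eLpNorm (fun ω : TreeBoundary G o => poissonTransform hG o z F (ω.vertex n)) r (measure hG o)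
      ≤ eLpNorm (fun ω : TreeBoundary G o =>
          poissonTransform hG o (Complex.I * z.im) normF (ω.vertex n)) r (measure hG o) :=
        eLpNorm_mono fun ω => norm_poissonTransform_le hG z F _
    _ ≤ ‖Q ^ n‖ₑ * ((∑ i ∈ Finset.range (n + 1), ‖sphericalWeight q (A : ℂ) i‖ₑ) *
          eLpNorm normF r (measure hG o)) := by
        rw [hexpand, eLpNorm_const_smul]
        gcongr
        exact eLpNorm_sum_smul_condExp_le hr _ _ _ _
    _ = _ := by
        rw [sum_enorm_sphericalWeight (norm_nonneg _) (one_le_mul_norm_natCast_cpow hG.pos hz),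
          hnormF_eLpNorm, ← mul_assoc, ← enorm_mul, sphericalFunction_vertex,
          natCast_cpow_two_mul_I_mul_I_mul_im hG.pos]

/-! ### Hardy norms -/

theorem sphericalMean_eq_eLpNorm (hG : IsHomogeneousTree G q) {r : ℝ≥0∞} (hr0 : r ≠ 0)
    (hr : r ≠ ∞) (u : V → ℂ) (n : ℕ) :
    sphericalMean G q o r.toReal u n =
      eLpNorm (fun ω : TreeBoundary G o => u (ω.vertex n)) r (measure hG o) := by
  rw [eLpNorm_eq_lintegral_rpow_enorm_toReal hr0 hr,
    lintegral_vertex hG n fun x => ‖u x‖ₑ ^ r.toReal]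
  rfl

theorem iSup_enorm_eq_iSup_eLpNorm_top (hG : IsHomogeneousTree G q) (w : ℕ → ℝ≥0∞) (u : V → ℂ) :
    ⨆ x, w (G.dist o x) * ‖u x‖ₑ = ⨆ n, w n *
      eLpNorm (fun ω : TreeBoundary G o => u (ω.vertex n)) ∞ (measure hG o) := by
  refine le_antisymm (iSup_le fun x => ?_) (iSup_le fun n => ?_)
  · obtain ⟨ω, hbound, hω⟩ := exists_vertex_eq_of_ae hG x (enorm_ae_le_eLpNormEssSup
      (fun ω : TreeBoundary G o => u (ω.vertex (G.dist o x))) (measure hG o))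
    rw [hω, ← eLpNorm_exponent_top] at hbound
    exact le_iSup_of_le (G.dist o x) (by gcongr)
  · rw [eLpNorm_exponent_top, eLpNormEssSup, ← ENNReal.essSup_const_mul]
    refine essSup_le_of_ae_le _ (.of_forall fun ω => le_iSup_of_le (ω.vertex n) ?_)
    rw [dist_vertex]

theorem sphericalFunction_eq_vertex_dist (hG : IsHomogeneousTree G q) (z : ℂ)
    (ω₀ : TreeBoundary G o) (x : V) :
    sphericalFunction hG o z x = sphericalFunction hG o z (ω₀.vertex (G.dist o x)) := by
  obtain ⟨ω, -, hω⟩ := exists_vertex_eq_of_ae (o := o) hG x (.of_forall fun _ => trivial)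
  nth_rw 1 [← hω]
  rw [sphericalFunction_vertex, sphericalFunction_vertex]

theorem hardyNorm_eq_iSup (hG : IsHomogeneousTree G q) (ω₀ : TreeBoundary G o) (p : ℝ)
    {r : ℝ≥0∞} (hr : r ≠ 0) (u : V → ℂ) :
    hardyNorm hG o ω₀ p r u = ⨆ n : ℕ,
      ‖sphericalFunction hG o (Complex.I * hardyDelta p) (ω₀.vertex n)‖ₑ⁻¹ *
        eLpNorm (fun ω : TreeBoundary G o => u (ω.vertex n)) r (measure hG o) := by
  unfold hardyNorm
  split_ifs with hr_top
  · rw [hr_top, ← iSup_enorm_eq_iSup_eLpNorm_top hG fun n =>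
      ‖sphericalFunction hG o (Complex.I * hardyDelta p) (ω₀.vertex n)‖ₑ⁻¹]
    simp_rw [← sphericalFunction_eq_vertex_dist]
  · simp_rw [sphericalMean_eq_eLpNorm hG hr hr_top]

theorem sphericalFunction_I_mul_im (hG : IsHomogeneousTree G q) {p : ℝ} {z : ℂ}
    (hz : z.im = -hardyDelta p) (x : V) :
    sphericalFunction hG o (Complex.I * z.im) x =
      sphericalFunction hG o (Complex.I * hardyDelta p) x := by
  rw [hz, Complex.ofReal_neg, mul_neg, sphericalFunction_neg]

theorem hardyDelta_nonneg {p : ℝ} (hp0 : 0 < p) (hp2 : p ≤ 2) : 0 ≤ hardyDelta p :=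
  sub_nonneg.2 (one_div_le_one_div_of_le hp0 hp2)

theorem hardyNorm_poissonTransform_le (hG : IsHomogeneousTree G q) (ω₀ : TreeBoundary G o) {p : ℝ}
    {z : ℂ} (hz : z.im = -hardyDelta p) (hz_le : z.im ≤ 1 / 2) {r : ℝ≥0∞} (hr : 1 ≤ r)
    {F : TreeBoundary G o → ℂ} (hF : Integrable F (measure hG o)) :
    hardyNorm hG o ω₀ p r (poissonTransform hG o z F) ≤ eLpNorm F r (measure hG o) := by
  rw [hardyNorm_eq_iSup hG ω₀ p (one_pos.trans_le hr).ne']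
  refine iSup_le fun n => ?_
  have hbound := eLpNorm_poissonTransform_vertex_le hG hz_le hr hF ω₀ n
  rw [sphericalFunction_I_mul_im hG hz] at hbound
  calc _ ≤ ‖sphericalFunction hG o (Complex.I * hardyDelta p) (ω₀.vertex n)‖ₑ⁻¹ *
        (‖sphericalFunction hG o (Complex.I * hardyDelta p) (ω₀.vertex n)‖ₑ *
          eLpNorm F r (measure hG o)) := by gcongr
    _ ≤ eLpNorm F r (measure hG o) := by
        rw [← mul_assoc]
        exact mul_le_of_le_one_left' (ENNReal.inv_mul_le_one _)

theorem tendsto_ae_poissonTransform_vertex_div (hG : IsHomogeneousTree G q) {z : ℂ}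
    (hz : z.im ≤ 0) {C : ℝ} (hC : 0 < C) (ω₀ : TreeBoundary G o)
    (hlower : ∀ᶠ n in atTop, C * ‖sphericalFunction hG o (Complex.I * z.im) (ω₀.vertex n)‖ ≤
      ‖sphericalFunction hG o z (ω₀.vertex n)‖)
    {F : TreeBoundary G o → ℂ} (hF : Integrable F (measure hG o)) :
    ∀ᵐ ω ∂(measure hG o), Tendsto (fun n => (sphericalFunction hG o z (ω₀.vertex n))⁻¹ *
      poissonTransform hG o z F (ω.vertex n)) atTop (𝓝 (F ω)) := by
  have hQ : ((q : ℂ) ^ (1 / 2 + Complex.I * z))⁻¹ ≠ 0 :=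
    inv_ne_zero (Complex.cpow_ne_zero_iff.2 (.inl (Nat.cast_ne_zero.2 hG.pos.ne')))
  have ha : 1 ≤ ‖(q : ℂ) ^ (2 * Complex.I * z)‖ := by
    rw [norm_natCast_cpow_two_mul_I_mul hG.pos]
    exact Real.one_le_rpow (Nat.one_le_cast.2 hG.pos) (by linarith)
  simp_rw [mul_norm_sphericalFunction_le_iff hG (hz.trans one_half_pos.le)] at hlower
  filter_upwards [tendsto_ae_condExp_vertexFiltration hG hF] with ω hω
  refine (tendsto_inv_sphericalSum_smul_sum hG.two_le ha hC hlower hω).congr fun n => ?_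
  rw [sphericalFunction_vertex, poissonTransform_vertex hG z hF, smul_eq_mul, mul_inv_rev,
    mul_assoc _ (_ ^ n)⁻¹, inv_mul_cancel_left₀ (pow_ne_zero n hQ)]

theorem ofReal_mul_enorm_inv_le {K : Type*} [NormedDivisionRing K] {C : ℝ} (hC : 0 < C) {u v : K}
    (h : C * ‖u‖ ≤ ‖v‖) : ENNReal.ofReal C * ‖v⁻¹‖ₑ ≤ ‖u‖ₑ⁻¹ := by
  rcases eq_or_ne u 0 with rfl | hu
  · simp
  have hu_pos : 0 < ‖u‖ := norm_pos_iff.2 hu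
  rw [← ofReal_norm, ← ofReal_norm, ← ENNReal.ofReal_inv_of_pos hu_pos,
    ← ENNReal.ofReal_mul hC.le, norm_inv]
  refine ENNReal.ofReal_le_ofReal ?_
  rw [← div_eq_mul_inv, div_le_iff₀ ((mul_pos hC hu_pos).trans_le h), ← div_eq_inv_mul]
  exact (le_div_iff₀ hu_pos).2 h

theorem mul_eLpNorm_le_hardyNorm_poissonTransform (hG : IsHomogeneousTree G q)
    (ω₀ : TreeBoundary G o) {p : ℝ} {z : ℂ} (hz : z.im = -hardyDelta p) (hz_nonpos : z.im ≤ 0)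
    {C : ℝ} (hC : 0 < C)
    (hlower : ∀ᶠ n in atTop, C * ‖sphericalFunction hG o (Complex.I * z.im) (ω₀.vertex n)‖ ≤
      ‖sphericalFunction hG o z (ω₀.vertex n)‖)
    {r : ℝ≥0∞} (hr : r ≠ 0) {F : TreeBoundary G o → ℂ} (hF : Integrable F (measure hG o)) :
    ENNReal.ofReal C * eLpNorm F r (measure hG o) ≤
      hardyNorm hG o ω₀ p r (poissonTransform hG o z F) := by
  let φ (n : ℕ) : ℂ := sphericalFunction hG o z (ω₀.vertex n)
  let f (n : ℕ) : TreeBoundary G o → ℂ := fun ω => poissonTransform hG o z F (ω.vertex n)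
  have hf_meas (n : ℕ) : AEStronglyMeasurable ((φ n)⁻¹ • f n) (measure hG o) := by
    let _ : MeasurableSpace V := ⊤
    have : Measurable (poissonTransform hG o z F) := .of_discrete
    exact (this.comp (measurable_vertex hG n)).aestronglyMeasurable.const_smul _
  have hfatou : eLpNorm F r (measure hG o) ≤
      liminf (fun n => eLpNorm ((φ n)⁻¹ • f n) r (measure hG o)) atTop :=
    Lp.eLpNorm_lim_le_liminf_eLpNorm hf_meas F
      (tendsto_ae_poissonTransform_vertex_div hG hz_nonpos hC ω₀ hlower hF)
  rw [mul_comm, ← ENNReal.le_div_iff_mul_le (by simp [hC]) (by simp)]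
  refine hfatou.trans (liminf_le_of_frequently_le' (Eventually.frequently ?_))
  filter_upwards [hlower] with n hn
  rw [sphericalFunction_I_mul_im hG hz] at hn
  have hweight := ofReal_mul_enorm_inv_le hC hn
  rw [ENNReal.le_div_iff_mul_le (by simp [hC]) (by simp), eLpNorm_const_smul,
    hardyNorm_eq_iSup hG ω₀ p hr, mul_comm, ← mul_assoc]
  exact le_iSup_of_le n (by gcongr)

/-- The constant `C_p` of the lower bound. It is independent of `q` because `|q ^ (2iz)|`, which
equals `q ^ (2 δ_p)` when `z` has imaginary part `-δ_p`, is at least `2 ^ (2 δ_p)`. -/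
noncomputable def hardyConstant (p : ℝ) : ℝ :=
  if p = 2 then 1 else (2 ^ (2 * hardyDelta p) - 1) / (2 * (2 ^ (2 * hardyDelta p) + 1))

theorem hardyDelta_pos {p : ℝ} (hp0 : 0 < p) (hp2 : p < 2) : 0 < hardyDelta p :=
  sub_pos.2 (one_div_lt_one_div_of_lt hp0 hp2)

theorem hardyConstant_pos {p : ℝ} (hp0 : 0 < p) (hp2 : p ≤ 2) : 0 < hardyConstant p := by
  unfold hardyConstant
  split_ifs with hp
  · exact one_pos
  · have hδ := hardyDelta_pos hp0 (hp2.lt_of_ne hp)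
    have : 1 < (2 : ℝ) ^ (2 * hardyDelta p) := Real.one_lt_rpow one_lt_two (by linarith)
    exact div_pos (by linarith) (by linarith)

theorem natCast_cpow_two_mul_I_mul_eq_one (hq : 1 < q) (k : ℤ) :
    (q : ℂ) ^ (2 * Complex.I * (2 * Real.pi / Real.log q / 2 * k : ℝ)) = 1 := by
  have hlog : Complex.log q ≠ 0 := by
    exact_mod_cast (Real.log_pos (Nat.one_lt_cast.2 hq)).ne'
  rw [Complex.cpow_def_of_ne_zero (Nat.cast_ne_zero.2 (by omega)), Complex.exp_eq_one_iff]
  refine ⟨k, ?_⟩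
  push_cast
  field_simp

theorem eventually_hardyConstant_mul_norm_sphericalFunction_le (hG : IsHomogeneousTree G q)
    (ω₀ : TreeBoundary G o) {p : ℝ} (hp0 : 0 < p) (hp2 : p ≤ 2) {z : ℂ}
    (hz : z.im = -hardyDelta p)
    (hz_re : p = 2 → ∃ k : ℤ, z.re = 2 * Real.pi / Real.log q / 2 * k) :
    ∀ᶠ n in atTop, hardyConstant p *
        ‖sphericalFunction hG o (Complex.I * z.im) (ω₀.vertex n)‖ ≤
      ‖sphericalFunction hG o z (ω₀.vertex n)‖ := by
  have hδ := hardyDelta_nonneg hp0 hp2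
  simp_rw [mul_norm_sphericalFunction_le_iff hG (by linarith : z.im ≤ 1 / 2)]
  rcases eq_or_ne p 2 with rfl | hp
  · obtain ⟨k, hk⟩ := hz_re rfl
    have hz_real : z = (2 * Real.pi / Real.log q / 2 * k : ℝ) :=
      Complex.ext (by rw [hk, Complex.ofReal_re])
        (by rw [hz, Complex.ofReal_im, hardyDelta, sub_self, neg_zero])
    refine .of_forall fun n => ?_
    rw [hz_real, natCast_cpow_two_mul_I_mul_eq_one hG.two_le, norm_one, hardyConstant,
      if_pos rfl, one_mul, ← Complex.ofReal_one, ← ofReal_sphericalSum, Complex.norm_real]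
    exact Real.le_norm_self _
  · have hδ_pos := hardyDelta_pos hp0 (hp2.lt_of_ne hp)
    rw [hardyConstant, if_neg hp]
    refine eventually_mul_sphericalSum_le_norm hG.pos
      (Real.one_lt_rpow one_lt_two (by linarith)) ?_
    rw [norm_natCast_cpow_two_mul_I_mul hG.pos, hz, neg_mul_neg]
    exact Real.rpow_le_rpow two_pos.le (Nat.ofNat_le_cast.2 hG.two_le) (by linarith)

end TreeBoundary

theorem mainTheorem4_general (p : ℝ) (hp0 : 0 < p) (hp2 : p ≤ 2) :
    ∃ C : ℝ, 0 < C ∧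
      ∀ {V : Type*} (G : SimpleGraph V) (q : ℕ) (hG : IsHomogeneousTree G q) (o : V)
        (ω₀ : TreeBoundary G o) (α : ℝ),
        (p = 2 → ∃ k : ℤ, α = (2 * Real.pi / Real.log q) / 2 * k) →
        ∀ r : ℝ≥0∞, 1 ≤ r → ∀ F : TreeBoundary G o → ℂ,
          Integrable F (TreeBoundary.measure hG o) →
          let z : ℂ := α + Complex.I * ((-TreeBoundary.hardyDelta p : ℝ) : ℂ)
          ENNReal.ofReal C * eLpNorm F r (TreeBoundary.measure hG o) ≤
              TreeBoundary.hardyNorm hG o ω₀ p r (TreeBoundary.poissonTransform hG o z F) ∧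
            TreeBoundary.hardyNorm hG o ω₀ p r (TreeBoundary.poissonTransform hG o z F) ≤
              eLpNorm F r (TreeBoundary.measure hG o) := by
  refine ⟨_, TreeBoundary.hardyConstant_pos hp0 hp2, ?_⟩
  intro V G q hG o ω₀ α hα r hr F hF z
  have hδ := TreeBoundary.hardyDelta_nonneg hp0 hp2
  have hre : z.re = α := by simp [z]
  have him : z.im = -TreeBoundary.hardyDelta p := by simp [z]
  have hlower := TreeBoundary.eventually_hardyConstant_mul_norm_sphericalFunction_le hG ω₀ hp0 hp2
    him (by rwa [hre])
  exact ⟨TreeBoundary.mul_eLpNorm_le_hardyNorm_poissonTransform hG ω₀ him (by linarith)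
      (TreeBoundary.hardyConstant_pos hp0 hp2) hlower (one_pos.trans_le hr).ne' hF,
    TreeBoundary.hardyNorm_poissonTransform_le hG ω₀ him (by linarith) hr hF⟩

theorem mainTheorem4 (p : ℝ) (hp1 : 1 ≤ p) (hp2 : p ≤ 2) :
    ∃ C : ℝ, 0 < C ∧
      ∀ {V : Type*} (G : SimpleGraph V) (q : ℕ) (hG : IsHomogeneousTree G q) (o : V)
        (ω₀ : TreeBoundary G o) (α : ℝ),
        (p = 2 → ∃ k : ℤ, α = (2 * Real.pi / Real.log q) / 2 * k) →
        ∀ r : ℝ≥0∞, 1 ≤ r → ∀ F : TreeBoundary G o → ℂ,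
          MemLp F r (TreeBoundary.measure hG o) →
          let z : ℂ := α + Complex.I * ((-TreeBoundary.hardyDelta p : ℝ) : ℂ)
          ENNReal.ofReal C * eLpNorm F r (TreeBoundary.measure hG o) ≤
              TreeBoundary.hardyNorm hG o ω₀ p r (TreeBoundary.poissonTransform hG o z F) ∧
            TreeBoundary.hardyNorm hG o ω₀ p r (TreeBoundary.poissonTransform hG o z F) ≤
              eLpNorm F r (TreeBoundary.measure hG o) := by
  obtain ⟨C, hC, h⟩ := mainTheorem4_general p (one_pos.trans_le hp1) hp2
  exact ⟨C, hC, fun G q hG o ω₀ α hα r hr F hF => h G q hG o ω₀ α hα r hr F (hF.integrable hr)⟩
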